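/- Let $f\colon[0,1]\to[0,1]$ be continuous. For $n\ge 1$ and $\varepsilon>0$ let $\operatorname{sep}(n,\varepsilon,f)$ be the maximal cardinality of a set $S\subseteq[0,1]$ such that $\max_{0\le i<n}|f^i(x)-f^i(y)|>\varepsilon$ for any two distinct points $x,y\in S$, and let $$h_{\mathrm{pol}}(f)=\lim_{\varepsilon\to0^+}\ \limsup_{n\to\infty}\frac{\log\operatorname{sep}(n,\varepsilon,f)}{\log n}\in[0,\infty]$$ be the polynomial entropy of $f$. The Sharkovskii order on $\{1,2,3,\dots\}\cup\{2^\infty\}$ is $$1\prec2\prec4\prec8\prec\cdots\prec2^\infty\prec\cdots\prec2^2\cdot7\prec2^2\cdot5\prec2^2\cdot3\prec\cdots\prec2\cdot7\prec2\cdot5\prec2\cdot3\prec\cdots\prec7\prec5\prec3.$$ The Sharkovskii type of $f$ is the $\prec$-greatest element of the set of (least) periods of the cycles of $f$, or $2^\infty$ if that set is exactly $\{2^k : k\ge0\}$. Then $h_{\mathrm{pol}}(f)=0$ if and only if the set of periodic points of $f$ is connected. Moreover, if $h_{\mathrm{pol}}(f)=0$, then the Sharkovskii type of $f$ is $1$ or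 $2$. -/

import Mathlib

open Filter Topology Function

noncomputable section

namespace IntervalDynamics

section Entropy

variable {X : Type*} [MetricSpace X]

/-- `S` is `(n, ε, f)`-separated: any two distinct points of `S` satisfy
`max_{0 ≤ i < n} d(fⁱ x, fⁱ y) > ε`. -/
def IsSeparatedSet (f : X → X) (n : ℕ) (ε : ℝ) (S : Set X) : Prop :=
  ∀ x ∈ S, ∀ y ∈ S, x ≠ y → ∃ i < n, ε < dist (f^[i] x) (f^[i] y)

/-- `sep (n, ε, f)`: the maximal cardinality of an `(n, ε, f)`-separated subset of `X`. -/
def sep (f : X → X) (n : ℕ) (ε : ℝ) : ℕ∞ :=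
  ⨆ (S : Set X) (_ : IsSeparatedSet f n ε S), S.encard

/-- The polynomial growth rate at scale `ε`: `limsup_{n → ∞} log sep (n, ε, f) / log n`,
as an extended real number. -/
def polEntropyAt (f : X → X) (ε : ℝ) : EReal :=
  limsup (fun n : ℕ => ENNReal.log (sep f n ε : ENNReal) / ((Real.log n : ℝ) : EReal)) atTop

/-- The polynomial entropy of `f`, the limit of `polEntropyAt f ε` as `ε → 0⁺`. The limit is
written as a supremum because `polEntropyAt f` is antitone; see `tendsto_polEntropyAt`. -/
def polEntropy (f : X → X) : EReal :=
  ⨆ (ε : ℝ) (_ : 0 < ε), polEntropyAt f ε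

theorem sep_antitone (f : X → X) (n : ℕ) : Antitone (sep f n) := by
  intro ε δ h
  refine iSup₂_le fun S hS => le_iSup₂_of_le S ?_ le_rfl
  intro x hx y hy hxy
  obtain ⟨i, hi, hd⟩ := hS x hx y hy hxy
  exact ⟨i, hi, h.trans_lt hd⟩

theorem polEntropyAt_antitone (f : X → X) : Antitone (polEntropyAt f) := by
  intro ε δ h
  refine limsup_le_limsup (Eventually.of_forall fun n => ?_)
  refine EReal.div_le_div_right_of_nonneg ?_ ?_
  · exact_mod_cast Real.log_natCast_nonneg n
  · refine ENNReal.log_monotone ?_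
    exact_mod_cast sep_antitone f n h

/-- The polynomial entropy is the limit of the growth rates as `ε` decreases to `0`. -/
theorem tendsto_polEntropyAt (f : X → X) :
    Tendsto (polEntropyAt f) (𝓝[>] 0) (𝓝 (polEntropy f)) := by
  have h := (polEntropyAt_antitone f).tendsto_nhdsGT (0 : ℝ)
  rwa [sSup_image] at h

end Entropy

section Sharkovskii

/-- The set `ℕ ∪ {2^∞}` on which the Sharkovskii order lives. -/
inductive SharkovskiiIndex : Type
  | num (n : ℕ) : SharkovskiiIndex
  | twoInfty : SharkovskiiIndex

open SharkovskiiIndex in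
/-- The (strict) Sharkovskii order on positive integers and `2^∞`:
`1 ≺ 2 ≺ 4 ≺ ⋯ ≺ 2^∞ ≺ ⋯ ≺ 2²·7 ≺ 2²·5 ≺ 2²·3 ≺ ⋯ ≺ 2·7 ≺ 2·5 ≺ 2·3 ≺ ⋯ ≺ 7 ≺ 5 ≺ 3`. -/
inductive SharkovskiiPrec : SharkovskiiIndex → SharkovskiiIndex → Prop
  | pow_pow (i j : ℕ) (hij : i < j) : SharkovskiiPrec (num (2 ^ i)) (num (2 ^ j))
  | pow_infty (i : ℕ) : SharkovskiiPrec (num (2 ^ i)) twoInfty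
  | pow_odd (i j q : ℕ) (hq : Odd q) (hq1 : 1 < q) :
      SharkovskiiPrec (num (2 ^ i)) (num (2 ^ j * q))
  | infty_odd (j q : ℕ) (hq : Odd q) (hq1 : 1 < q) :
      SharkovskiiPrec twoInfty (num (2 ^ j * q))
  | odd_odd_of_lt (i j q r : ℕ) (hq : Odd q) (hq1 : 1 < q) (hr : Odd r) (hr1 : 1 < r)
      (hji : j < i) : SharkovskiiPrec (num (2 ^ i * q)) (num (2 ^ j * r))
  | odd_odd_same (i q r : ℕ) (hq : Odd q) (hr : Odd r) (hr1 : 1 < r) (hrq : r < q) :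
      SharkovskiiPrec (num (2 ^ i * q)) (num (2 ^ i * r))

/-- The set of (least) periods of the cycles of `f`. -/
def cyclePeriods {X : Type*} (f : X → X) : Set ℕ :=
  {n | 0 < n ∧ ∃ x, minimalPeriod f x = n}

/-- `f` has Sharkovskii type `t`: either `t` is an integer which is the greatest period of a cycle
of `f` in the Sharkovskii order, or `t = 2^∞` and the periods are exactly the powers of `2`. -/
def HasSharkovskiiType {X : Type*} (f : X → X) : SharkovskiiIndex → Prop
  | .num n => n ∈ cyclePeriods f ∧
      ∀ m ∈ cyclePeriods f, m = n ∨ SharkovskiiPrec (.num m) (.num n)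
  | .twoInfty => cyclePeriods f = {n | ∃ k : ℕ, n = 2 ^ k}

end Sharkovskii

end IntervalDynamics

end

/-! If a non-periodic point lies between periodic points `p` and `q`, a suitable iterate `f^k` fixes
`p` and `q` but not that point. The intermediate value theorem gives a strictly monotone backward
orbit of `f^k` (`exists_strictMono_backward_orbit`); its points reach its end point at different
times, so separation numbers grow at least linearly (`le_sep_of_backward_orbit`). Conversely, if the
periodic points form an interval, `f` is injective on it, so `f²` is the identity there
(`iterate_two_eq_of_mem_periodicPts`). This bounds the periods by two. The images of the iterates of
`g = f²` shrink to that interval (`iInter_range_iterate_subset`), and orbits staying near it hardly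
move, so the iterates are equicontinuous and separation numbers are bounded. -/

namespace IntervalDynamics

/-! ### Growth of separation numbers and polynomial entropy -/

section EntropyBounds

variable {X : Type*} [MetricSpace X]

theorem one_le_sep [Nonempty X] (f : X → X) (n : ℕ) (ε : ℝ) : 1 ≤ sep f n ε := by
  obtain ⟨x⟩ := ‹Nonempty X›
  refine le_iSup₂_of_le ({x} : Set X) ?_ (by simp)
  rintro y rfl z rfl h
  exact absurd rfl h

theorem polEntropyAt_nonneg [Nonempty X] (f : X → X) (ε : ℝ) : 0 ≤ polEntropyAt f ε := by
  refine le_limsup_of_frequently_le' (Eventually.of_forall fun n => ?_).frequently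
  refine EReal.div_nonneg ?_ (by exact_mod_cast Real.log_natCast_nonneg n)
  rw [ENNReal.zero_le_log_iff]
  exact_mod_cast one_le_sep f n ε

theorem polEntropyAt_nonpos_of_sep_le (f : X → X) (ε : ℝ) (M : ℕ) (hM : 0 < M)
    (h : ∀ n, sep f n ε ≤ M) : polEntropyAt f ε ≤ 0 := by
  have hlim : Tendsto (fun n : ℕ => ((Real.log M / Real.log n : ℝ) : EReal)) atTop
      (𝓝 ((0 : ℝ) : EReal)) := by
    refine (continuous_coe_real_ereal.tendsto 0).comp ?_
    exact tendsto_const_nhds.div_atTop (Real.tendsto_log_atTop.comp tendsto_natCast_atTop_atTop)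
  rw [← EReal.coe_zero, ← hlim.limsup_eq]
  refine limsup_le_limsup (Eventually.of_forall fun n => ?_)
  simp only [EReal.coe_div]
  refine EReal.div_le_div_right_of_nonneg (by exact_mod_cast Real.log_natCast_nonneg n) ?_
  have hle : (sep f n ε : ENNReal) ≤ ENNReal.ofReal M := by
    rw [ENNReal.ofReal_natCast]
    exact_mod_cast h n
  refine (ENNReal.log_monotone hle).trans_eq ?_
  exact ENNReal.log_ofReal_of_pos (by exact_mod_cast hM)

/-- If the separation numbers grow linearly along multiples of `k`, then the growth rate is
positive. -/
theorem polEntropyAt_pos_of_le_sep (f : X → X) (ε : ℝ) (k : ℕ) (hk : 0 < k)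
    (h : ∀ n : ℕ, (n : ℕ∞) ≤ sep f (k * n) ε) : 0 < polEntropyAt f ε := by
  have hhalf : (0 : EReal) < ((1 / 2 : ℝ) : EReal) := by exact_mod_cast one_half_pos
  refine hhalf.trans_le (le_limsup_of_frequently_le' ?_)
  rw [frequently_atTop]
  intro m
  -- With `k ≤ n`, `log (k * n) ≤ 2 * log n`, whence the ratio `1 / 2`.
  obtain ⟨n, hn⟩ : ∃ n, n = max m (max k 2) := ⟨_, rfl⟩
  have hkn : k ≤ n := by omega
  have hn2 : 2 ≤ n := by omega
  refine ⟨k * n, le_trans (by omega : m ≤ n) (Nat.le_mul_of_pos_left n hk), ?_⟩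
  have hk1 : (1 : ℝ) ≤ k := by exact_mod_cast hk
  have hn2' : (2 : ℝ) ≤ n := by exact_mod_cast hn2
  have hkn' : (k : ℝ) ≤ n := by exact_mod_cast hkn
  have hpos : 0 < Real.log ((k * n : ℕ) : ℝ) := by
    refine Real.log_pos ?_
    push_cast
    nlinarith
  have hle : Real.log ((k * n : ℕ) : ℝ) ≤ 2 * Real.log n := by
    push_cast
    rw [Real.log_mul (by positivity) (by positivity), two_mul]
    gcongr
  rw [EReal.le_div_iff_mul_le (by exact_mod_cast hpos) (EReal.coe_ne_top _), ← EReal.coe_mul]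
  have hlog : ENNReal.log (ENNReal.ofReal n) ≤ ENNReal.log (sep f (k * n) ε : ENNReal) := by
    refine ENNReal.log_monotone ?_
    rw [ENNReal.ofReal_natCast]
    exact_mod_cast h n
  refine le_trans ?_ hlog
  rw [ENNReal.log_ofReal_of_pos (by positivity)]
  exact_mod_cast (by linarith)

/-- A backward orbit that never returns close to its end point forces linear growth of the
separation numbers. -/
theorem le_sep_of_backward_orbit (f : X → X) (k : ℕ) (hk : 0 < k) (z : ℕ → X)
    (hz : ∀ n, f^[k] (z (n + 1)) = z n) (ε : ℝ) (hε : 0 ≤ ε)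
    (hd : ∀ n, ε < dist (z 0) (z (n + 1))) (n : ℕ) : (n : ℕ∞) ≤ sep f (k * n) ε := by
  have hiter : ∀ i j, f^[k * i] (z (i + j)) = z j := by
    intro i
    induction i with
    | zero => intro j; simp
    | succ i ih =>
      intro j
      have := ih (j + 1)
      rw [show i + 1 + j = i + (j + 1) by omega, show k * (i + 1) = k + k * i by ring,
        iterate_add_apply, this, hz]
  -- At time `k * i` the point `z i` has reached `z 0`, while `z j` is only at `z (j - i)`.
  have hsep : ∀ i j, i < j → ε < dist (f^[k * i] (z i)) (f^[k * i] (z j)) := by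
    intro i j hij
    have h1 := hiter i 0
    have h2 := hiter i (j - i - 1 + 1)
    rw [show i + (j - i - 1 + 1) = j by omega] at h2
    rw [add_zero] at h1
    rw [h1, h2]
    exact hd _
  have hinj : Injective z := by
    intro i j hij
    by_contra hne
    rcases lt_or_gt_of_ne hne with h | h
    · have := hsep i j h
      rw [hij, dist_self] at this
      linarith
    · have := hsep j i h
      rw [hij, dist_self] at this
      linarith
  refine le_iSup₂_of_le (z '' (Finset.range n : Set ℕ)) ?_ ?_
  · rintro _ ⟨i, hi, rfl⟩ _ ⟨j, hj, rfl⟩ hne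
    simp only [Finset.coe_range, Set.mem_Iio] at hi hj
    have hij : i ≠ j := fun h => hne (h ▸ rfl)
    rcases lt_or_gt_of_ne hij with h | h
    · exact ⟨k * i, Nat.mul_lt_mul_of_pos_left hi hk, hsep i j h⟩
    · refine ⟨k * j, Nat.mul_lt_mul_of_pos_left hj hk, ?_⟩
      rw [dist_comm]
      exact hsep j i h
  · rw [hinj.encard_image, Set.encard_coe_eq_coe_finsetCard, Finset.card_range]

/-- Uniformly equicontinuous iterates on a compact space have bounded separation numbers. -/
theorem polEntropy_eq_zero_of_equicontinuous [Nonempty X] [CompactSpace X] (f : X → X)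
    (h : ∀ ε > 0, ∃ δ > 0, ∀ x y, dist x y < δ → ∀ n, dist (f^[n] x) (f^[n] y) ≤ ε) :
    polEntropy f = 0 := by
  refine le_antisymm (iSup₂_le fun ε hε => ?_)
    (le_iSup₂_of_le (1 : ℝ) one_pos (polEntropyAt_nonneg f 1))
  obtain ⟨δ, hδ, hf⟩ := h ε hε
  obtain ⟨t, -, ht, hcov⟩ := finite_cover_balls_of_compact (isCompact_univ (X := X)) (half_pos hδ)
  have hex : ∀ x, ∃ c ∈ t, dist x c < δ / 2 := fun x => by
    simpa using hcov (Set.mem_univ x)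
  choose c hct hc using hex
  have hsep : ∀ n, sep f n ε ≤ (ht.toFinset.card : ℕ∞) := by
    intro n
    refine iSup₂_le fun S hS => ?_
    rw [← Set.encard_coe_eq_coe_finsetCard, ht.coe_toFinset]
    -- Points sharing a centre are `δ`-close, so their orbits never separate by more than `ε`.
    refine Set.encard_le_encard_of_injOn (fun x _ => hct x) ?_
    intro x hx y hy hxy
    by_contra hne
    obtain ⟨i, -, hi⟩ := hS x hx y hy hne
    refine absurd (hf x y ?_ i) (not_le.2 hi)
    have h1 := hc x
    have h2 := hc y
    rw [← hxy] at h2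
    linarith [dist_triangle_right x y (c x)]
  refine polEntropyAt_nonpos_of_sep_le f ε _ ?_ hsep
  obtain ⟨x⟩ := ‹Nonempty X›
  exact Finset.card_pos.2 ⟨c x, by simpa using hct x⟩

end EntropyBounds

/-! ### Equicontinuity of iterates on compact spaces -/

section Equicontinuity

variable {X : Type*} [MetricSpace X] [CompactSpace X]

theorem exists_forall_dist_iterate_lt {f : X → X} (hf : Continuous f) (N : ℕ) {ε : ℝ}
    (hε : 0 < ε) : ∃ δ > 0, ∀ x y, dist x y < δ → ∀ n ≤ N, dist (f^[n] x) (f^[n] y) < ε := by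
  have huc : ∀ n, ∃ δ > 0, ∀ x y, dist x y < δ → dist (f^[n] x) (f^[n] y) < ε := fun n =>
    (Metric.uniformContinuous_iff.1
      (CompactSpace.uniformContinuous_of_continuous (hf.iterate n)) ε hε).imp
      fun δ h => ⟨h.1, fun _ _ => @h.2 _ _⟩
  induction N with
  | zero =>
    refine ⟨ε, hε, fun x y h n hn => ?_⟩
    obtain rfl : n = 0 := by omega
    exact h
  | succ N ih =>
    obtain ⟨δ, hδ, h⟩ := ih
    obtain ⟨δ', hδ', h'⟩ := huc (N + 1)
    refine ⟨min δ δ', lt_min hδ hδ', fun x y hxy n hn => ?_⟩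
    rcases Nat.le_succ_iff.1 hn with hn | rfl
    · exact h x y (hxy.trans_le (min_le_left _ _)) n hn
    · exact h' x y (hxy.trans_le (min_le_right _ _))

/-- If orbits eventually stop moving, uniformly in the starting point, then the iterates are
equicontinuous. -/
theorem equicontinuous_iterate_of_eventually_small {f : X → X} (hf : Continuous f)
    (h : ∀ ε > 0, ∃ N, ∀ x n, dist (f^[n] (f^[N] x)) (f^[N] x) ≤ ε) :
    ∀ ε > 0, ∃ δ > 0, ∀ x y, dist x y < δ → ∀ n, dist (f^[n] x) (f^[n] y) ≤ ε := by
  intro ε hε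
  obtain ⟨N, hN⟩ := h (ε / 3) (by positivity)
  obtain ⟨δ, hδ, hd⟩ := exists_forall_dist_iterate_lt hf N (by positivity : 0 < ε / 3)
  refine ⟨δ, hδ, fun x y hxy n => ?_⟩
  rcases le_or_gt n N with hn | hn
  · linarith [hd x y hxy n hn]
  · obtain ⟨m, rfl⟩ : ∃ m, n = m + N := ⟨n - N, by omega⟩
    rw [iterate_add_apply, iterate_add_apply]
    have h1 := hN x m
    have h2 := hN y m
    have h3 := hd x y hxy N le_rfl
    rw [dist_comm] at h2
    linarith [dist_triangle4 (f^[m] (f^[N] x)) (f^[N] x) (f^[N] y) (f^[m] (f^[N] y))]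

/-- Permits passing to `f²`, for which the periodic points of `f` will all be fixed. -/
theorem equicontinuous_iterate_of_sq {f : X → X} (hf : Continuous f)
    (h : ∀ ε > 0, ∃ δ > 0, ∀ x y, dist x y < δ →
      ∀ n, dist ((f^[2])^[n] x) ((f^[2])^[n] y) ≤ ε) :
    ∀ ε > 0, ∃ δ > 0, ∀ x y, dist x y < δ → ∀ n, dist (f^[n] x) (f^[n] y) ≤ ε := by
  intro ε hε
  obtain ⟨δ, hδ, hd⟩ := h ε hε
  obtain ⟨η, hη, he⟩ := exists_forall_dist_iterate_lt hf 1 hδ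
  refine ⟨η, hη, fun x y hxy n => ?_⟩
  obtain ⟨r, q, hr, rfl⟩ : ∃ r q, r ≤ 1 ∧ n = 2 * q + r := ⟨n % 2, n / 2, by omega, by omega⟩
  rw [iterate_add_apply, iterate_add_apply, iterate_mul]
  exact hd _ _ (he x y hxy r hr) q

/-- A continuous self-map of a compact space is onto the intersection of its iterated images. -/
theorem exists_preimage_mem_iInter_range {f : X → X} (hf : Continuous f) {y : X}
    (hy : y ∈ ⋂ n, Set.range f^[n]) : ∃ x ∈ ⋂ n, Set.range f^[n], f x = y := by
  have hcl : ∀ n, IsClosed (Set.range f^[n]) := fun n =>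
    (isCompact_range (hf.iterate n)).isClosed
  have hne := IsCompact.nonempty_iInter_of_sequence_nonempty_isCompact_isClosed
    (fun n => f ⁻¹' {y} ∩ Set.range f^[n]) (fun n => ?_) (fun n => ?_) ?_ (fun n => ?_)
  · obtain ⟨x, hx⟩ := hne
    simp only [Set.mem_iInter] at hx
    exact ⟨x, Set.mem_iInter.2 fun n => (hx n).2, (hx 0).1⟩
  · refine Set.inter_subset_inter_right _ ?_
    rintro _ ⟨u, rfl⟩
    exact ⟨f u, (iterate_succ_apply f n u).symm⟩
  · obtain ⟨u, hu⟩ := Set.mem_iInter.1 hy (n + 1)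
    exact ⟨f^[n] u, by rw [Set.mem_preimage, ← iterate_succ_apply' f n u]; exact hu, u, rfl⟩
  · exact ((isClosed_singleton.preimage hf).inter (hcl 0)).isCompact
  · exact (isClosed_singleton.preimage hf).inter (hcl n)

end Equicontinuity

/-! ### Periodic points of increasing maps -/

section Order

variable {α : Type*} [LinearOrder α]

theorem eq_of_strictMonoOn_of_iterate_eq {h : α → α} {s : Set α} (hmono : StrictMonoOn h s)
    (hmaps : Set.MapsTo h s s) {x : α} (hx : x ∈ s) {n : ℕ} (hn : 0 < n) (hper : h^[n] x = x) :
    h x = x := by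
  have hmem : ∀ i, h^[i] x ∈ s := fun i => hmaps.iterate i hx
  rcases lt_trichotomy (h x) x with hlt | heq | hgt
  · have : ∀ i, h^[i + 1] x < x := by
      intro i
      induction i with
      | zero => simpa using hlt
      | succ i ih =>
        rw [iterate_succ_apply']
        exact (hmono (hmem _) hx ih).trans hlt
    obtain ⟨m, rfl⟩ : ∃ m, n = m + 1 := ⟨n - 1, by omega⟩
    exact absurd hper (this m).ne
  · exact heq
  · have : ∀ i, x < h^[i + 1] x := by
      intro i
      induction i with
      | zero => simpa using hgt
      | succ i ih =>
        rw [iterate_succ_apply']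
        exact hgt.trans (hmono hx (hmem _) ih)
    obtain ⟨m, rfl⟩ : ∃ m, n = m + 1 := ⟨n - 1, by omega⟩
    exact absurd hper (this m).ne'

end Order

/-! ### Periodic points and backward orbits on a line -/

section Interval

variable {α : Type*} [ConditionallyCompleteLinearOrder α] [TopologicalSpace α] [OrderTopology α]
  [DenselyOrdered α]

/-- If the set of periodic points is order-connected, then all periods are at most two. -/
theorem iterate_two_eq_of_mem_periodicPts {f : α → α} (hf : Continuous f)
    (hconn : (periodicPts f).OrdConnected) {x : α} (hx : x ∈ periodicPts f) : f^[2] x = x := by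
  have hbij := bijOn_periodicPts f
  have : Inhabited (periodicPts f) := ⟨⟨x, hx⟩⟩
  let F : periodicPts f → α := fun y => f y
  have hF : StrictMono F ∨ StrictAnti F :=
    Continuous.strictMono_of_inj (hf.comp continuous_subtype_val)
      fun y z hyz => Subtype.ext (hbij.injOn y.2 z.2 hyz)
  have hmaps : Set.MapsTo f^[2] (periodicPts f) (periodicPts f) := hbij.mapsTo.iterate 2
  have hmono : StrictMonoOn f^[2] (periodicPts f) := by
    intro y hy z hz hyz
    have hy' := hbij.mapsTo hy
    have hz' := hbij.mapsTo hz
    change f (f y) < f (f z)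
    rcases hF with hF | hF
    · exact @hF ⟨f y, hy'⟩ ⟨f z, hz'⟩ (@hF ⟨y, hy⟩ ⟨z, hz⟩ hyz)
    · exact @hF ⟨f z, hz'⟩ ⟨f y, hy'⟩ (@hF ⟨y, hy⟩ ⟨z, hz⟩ hyz)
  obtain ⟨n, hn, hper⟩ := hx
  refine eq_of_strictMonoOn_of_iterate_eq hmono hmaps ⟨n, hn, hper⟩ hn ?_
  rw [← iterate_mul, mul_comm, iterate_mul]
  exact iterate_fixed hper 2

/-- A non-fixed point that moves away from a fixed point on its left has a strictly decreasing
backward orbit. -/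
theorem exists_antitone_backward_orbit {g : α → α} (hg : Continuous g) {p x : α} (hp : g p = p)
    (hpx : p < x) (hx : x < g x) :
    ∃ z : ℕ → α, (∀ n, g (z (n + 1)) = z n) ∧ StrictAnti z := by
  -- Beyond the largest fixed point `p'` in `[p, x]`, `g` moves points to the right, so each `t` in
  -- `(p', x]` has a preimage in `(p', t)`.
  obtain ⟨p', ⟨⟨hpp', hp'x⟩, hp'⟩, hmax⟩ :=
    (isCompact_Icc.inter_right (isClosed_eq hg continuous_id)).exists_isGreatest
      (⟨p, ⟨le_rfl, hpx.le⟩, hp⟩ : (Set.Icc p x ∩ {t | g t = id t}).Nonempty)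
  change g p' = p' at hp'
  have hp'x : p' < x := hp'x.lt_of_ne (by rintro rfl; exact hx.ne' hp')
  have hstep : ∀ t : Set.Ioc p' x, ∃ s : Set.Ioc p' x, s < t ∧ g s = t := by
    rintro ⟨t, hpt, htx⟩
    have hgt : t < g t := by
      by_contra! hle
      obtain ⟨c, ⟨hc1, hc2⟩, hc⟩ := isPreconnected_Icc.intermediate_value₂
        (Set.left_mem_Icc.2 htx) (Set.right_mem_Icc.2 htx) hg.continuousOn continuousOn_id
        hle hx.le
      exact (hpt.trans_le hc1).not_ge (hmax ⟨⟨hpp'.trans (hpt.le.trans hc1), hc2⟩, hc⟩)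
    obtain ⟨s, ⟨hs1, hs2⟩, hs⟩ := intermediate_value_Icc hpt.le hg.continuousOn
      (⟨by rw [hp']; exact hpt.le, hgt.le⟩ : t ∈ Set.Icc (g p') (g t))
    have hs1 : p' < s := hs1.lt_of_ne (by rintro rfl; exact hpt.ne (hp'.symm.trans hs))
    have hs2 : s < t := hs2.lt_of_ne (by rintro rfl; exact hgt.ne' hs)
    exact ⟨⟨s, hs1, hs2.le.trans htx⟩, hs2, hs⟩
  choose φ hφ hgφ using hstep
  have hxmem : x ∈ Set.Ioc p' x := ⟨hp'x, le_rfl⟩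
  refine ⟨fun n => (φ^[n] ⟨x, hxmem⟩).1, fun n => ?_, strictAnti_nat_of_succ_lt fun n => ?_⟩
  · simp only [iterate_succ_apply']
    exact hgφ _
  · simp only [iterate_succ_apply']
    exact hφ _

/-- A non-fixed point between two fixed points has a strictly monotone backward orbit. -/
theorem exists_strictMono_backward_orbit {g : α → α} (hg : Continuous g) {p q x : α}
    (hp : g p = p) (hq : g q = q) (hpx : p < x) (hxq : x < q) (hx : g x ≠ x) :
    ∃ z : ℕ → α, (∀ n, g (z (n + 1)) = z n) ∧ (StrictAnti z ∨ StrictMono z) := by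
  rcases lt_or_gt_of_ne hx with h | h
  · obtain ⟨z, hz, hm⟩ := exists_antitone_backward_orbit (α := αᵒᵈ) hg hq hxq h
    exact ⟨z, hz, Or.inr fun i j hij => hm hij⟩
  · obtain ⟨z, hz, hm⟩ := exists_antitone_backward_orbit hg hp hpx h
    exact ⟨z, hz, Or.inl hm⟩

end Interval

/-! ### The dichotomy on the unit interval -/

section UnitInterval

theorem dist_coe (x y : unitInterval) : dist x y = |(x : ℝ) - y| := rfl

/-- A map of the unit interval whose periodic points do not form an interval has positive
polynomial entropy. -/
theorem polEntropy_pos_of_not_ordConnected {f : unitInterval → unitInterval} (hf : Continuous f)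
    (h : ¬ (periodicPts f).OrdConnected) : 0 < polEntropy f := by
  rw [Set.ordConnected_def] at h
  push Not at h
  obtain ⟨p, ⟨m, hm, hpm⟩, q, ⟨n, hn, hqn⟩, hpq⟩ := h
  obtain ⟨x, ⟨hpx, hxq⟩, hx⟩ := Set.not_subset.1 hpq
  have hk : 0 < m * n := Nat.mul_pos hm hn
  have hp : f^[m * n] p = p := hpm.mul_const n
  have hq : f^[m * n] q = q := hqn.const_mul m
  have hxk : f^[m * n] x ≠ x := fun hfix => hx ⟨m * n, hk, hfix⟩
  have hpx : p < x := hpx.lt_of_ne (by rintro rfl; exact hxk hp)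
  have hxq : x < q := hxq.lt_of_ne (by rintro rfl; exact hxk hq)
  obtain ⟨z, hz, hmono⟩ := exists_strictMono_backward_orbit (hf.iterate (m * n)) hp hq hpx hxq hxk
  have hne : z 0 ≠ z 1 := by
    rcases hmono with hmono | hmono
    · exact hmono.injective.ne (by norm_num)
    · exact hmono.injective.ne (by norm_num)
  have hd : 0 < dist (z 0) (z 1) := dist_pos.2 hne
  refine lt_of_lt_of_le ?_ (le_iSup₂_of_le (dist (z 0) (z 1) / 2) (half_pos hd) le_rfl)
  refine polEntropyAt_pos_of_le_sep f _ (m * n) hk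
    (le_sep_of_backward_orbit f (m * n) hk z hz _ (half_pos hd).le fun i => ?_)
  -- By monotonicity `z 1` is the closest to `z 0` among the later points; halving makes the bound
  -- strict.
  refine (half_lt_self hd).trans_le ?_
  rcases hmono with hmono | hmono
  · have h1 : (z (i + 1) : ℝ) ≤ z 1 := hmono.antitone (Nat.le_add_left 1 i)
    have h2 : (z 1 : ℝ) ≤ z 0 := hmono.antitone zero_le_one
    rw [dist_coe, dist_coe, abs_of_nonneg (by linarith), abs_of_nonneg (by linarith)]
    linarith
  · have h1 : (z 1 : ℝ) ≤ z (i + 1) := hmono.monotone (Nat.le_add_left 1 i)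
    have h2 : (z 0 : ℝ) ≤ z 1 := hmono.monotone zero_le_one
    rw [dist_coe, dist_coe, abs_of_nonpos (by linarith), abs_of_nonpos (by linarith)]
    linarith

variable {g : unitInterval → unitInterval} {a b : unitInterval}

theorem lt_apply_of_lt (hg : Continuous g) (hfix : ∀ x, g x = x → x ∈ Set.Icc a b)
    {x : unitInterval} (hx : x < a) : x < g x := by
  by_contra! hle
  obtain ⟨c, hc, hgc⟩ := exists_mem_Icc_isFixedPt hg.continuousOn bot_le bot_le hle
  exact (hc.2.trans_lt hx).not_ge (hfix c hgc).1

theorem apply_lt_of_lt (hg : Continuous g) (hfix : ∀ x, g x = x → x ∈ Set.Icc a b)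
    {x : unitInterval} (hx : b < x) : g x < x := by
  by_contra! hle
  obtain ⟨c, hc, hgc⟩ := exists_mem_Icc_isFixedPt hg.continuousOn le_top hle le_top
  exact (hx.trans_le hc.1).not_ge (hfix c hgc).2

/-- Without further fixed points of the second iterate, the iterated images of the unit interval
shrink to the interval of fixed points. -/
theorem iInter_range_iterate_subset (hg : Continuous g) (hab : a ≤ b)
    (hfix : ∀ x, g x = x ↔ x ∈ Set.Icc a b) (hfix₂ : ∀ x, g (g x) = x → x ∈ Set.Icc a b) :
    ⋂ n, Set.range g^[n] ⊆ Set.Icc a b := by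
  set K := ⋂ n, Set.range g^[n] with hK
  have hlt : ∀ {x}, x < a → x < g x := lt_apply_of_lt hg fun x => (hfix x).1
  have hgt : ∀ {x}, b < x → g x < x := apply_lt_of_lt hg fun x => (hfix x).1
  have hpre : ∀ y ∈ K, ∃ x ∈ K, g x = y := fun y => exists_preimage_mem_iInter_range hg
  have hKc : IsCompact K :=
    (isClosed_iInter fun n => (isCompact_range (hg.iterate n)).isClosed).isCompact
  have haK : a ∈ K := Set.mem_iInter.2 fun n =>
    ⟨a, iterate_fixed ((hfix a).2 ⟨le_rfl, hab⟩) n⟩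
  obtain ⟨c, hcK, hc⟩ := hKc.exists_isLeast ⟨a, haK⟩
  obtain ⟨d, hdK, hd⟩ := hKc.exists_isGreatest ⟨a, haK⟩
  obtain ⟨y, hyK, hy⟩ := hpre c hcK
  obtain ⟨z, hzK, hz⟩ := hpre d hdK
  -- Points left of `a` move right and `[a, b]` is fixed, so a minimum `c < a` of `K` can only come
  -- from beyond `b`; symmetrically for `d`.
  have hby_of_lt : c < a → b < y := by
    intro hca
    by_contra! hyb
    rcases lt_or_ge y a with hya | hya
    · exact ((hc hyK).trans_lt (hlt hya)).ne' hy
    · rw [(hfix y).2 ⟨hya, hyb⟩] at hy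
      exact hca.not_ge (hy ▸ hya)
  have hdc : b < d → z < a := by
    intro hbd
    by_contra! hza
    rcases le_or_gt z b with hzb | hzb
    · rw [(hfix z).2 ⟨hza, hzb⟩] at hz
      exact hbd.not_ge (hz ▸ hzb)
    · exact ((hgt hzb).trans_le (hd hzK)).ne hz
  have hbd : d ≤ b := by
    by_contra! hbd
    have hza := hdc hbd
    have hca : c < a := (hc hzK).trans_lt hza
    have hga : g a = a := (hfix a).2 ⟨le_rfl, hab⟩
    have hby : b < y := hby_of_lt hca
    -- Here `g (g w) = g y = c ≤ w` while `c ≤ g (g c)`, which forces a fixed point of `g²` in `[c,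
    -- w]`, left of `a`.
    obtain ⟨w, ⟨hzw, hwa⟩, hw⟩ := intermediate_value_Icc' hza.le hg.continuousOn
      (⟨by rw [hga]; exact hab.trans hby.le, by rw [hz]; exact hd hyK⟩ :
        y ∈ Set.Icc (g a) (g z))
    have hwa : w < a := hwa.lt_of_ne (by
      rintro rfl
      exact (hab.trans_lt hby).ne (hga.symm.trans hw))
    have hcw : c ≤ w := (hc hzK).trans hzw
    have hggc : c ≤ g (g c) := by
      refine hc (Set.mem_iInter.2 fun n => ?_)
      obtain ⟨u, hu⟩ := Set.mem_iInter.1 hcK n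
      refine ⟨g (g u), ?_⟩
      rw [← iterate_succ_apply, ← iterate_succ_apply, iterate_succ_apply', iterate_succ_apply', hu]
    obtain ⟨u, hu, hgu⟩ := exists_mem_Icc_isFixedPt (f := fun t => g (g t))
      (hg.comp hg).continuousOn hcw hggc (by rw [hw, hy]; exact hcw)
    exact (hu.2.trans_lt hwa).not_ge (hfix₂ u hgu).1
  have hac : a ≤ c := by
    by_contra! hca
    exact ((hby_of_lt hca).trans_le (hd hyK)).not_ge hbd
  exact fun x hx => ⟨hac.trans (hc hx), (hd hx).trans hbd⟩

theorem dist_iterate_le_of_near_left (hg : Continuous g) (hab : a < b)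
    (hfix : ∀ x, g x = x ↔ x ∈ Set.Icc a b) {η : ℝ} (hη : 0 < η) :
    ∃ δ > 0, ∀ x < a, dist x a < δ → ∀ n, dist (g^[n] x) x ≤ η := by
  have hab' : (a : ℝ) < b := hab
  have hlt : ∀ {x}, x < a → x < g x := lt_apply_of_lt hg fun x => (hfix x).1
  have hga : g a = a := (hfix a).2 ⟨le_rfl, hab.le⟩
  -- The orbit increases while left of `a`. The bound `b - a` makes any overshoot land in `[a, b]`,
  -- where it stops; `η / 2` bounds the displacement.
  obtain ⟨δ, hδ, hd⟩ := Metric.continuousAt_iff.1 (hg.continuousAt (x := a))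
    (min (η / 2) (b - a)) (lt_min (by positivity) (by linarith))
  rw [hga] at hd
  refine ⟨min δ (η / 2), lt_min hδ (by positivity), fun x hxa hx n => ?_⟩
  have hinv : x ≤ g^[n] x ∧ (g^[n] x : ℝ) < a + min (η / 2) (b - a) := by
    induction n with
    | zero =>
      refine ⟨le_rfl, ?_⟩
      have h1 : (x : ℝ) < a := hxa
      have h2 : 0 < min (η / 2) ((b : ℝ) - a) := lt_min (by positivity) (by linarith)
      change (x : ℝ) < _
      linarith
    | succ n ih =>
      rw [iterate_succ_apply']
      obtain ⟨ih1, ih2⟩ := ih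
      rcases lt_or_ge (g^[n] x) a with h | h
      · refine ⟨ih1.trans (hlt h).le, ?_⟩
        have h1 : (x : ℝ) ≤ g^[n] x := ih1
        have h2 : (g^[n] x : ℝ) < a := h
        have h3 : dist (g^[n] x) a < δ := by
          refine lt_of_le_of_lt ?_ (hx.trans_le (min_le_left _ _))
          rw [dist_coe, dist_coe, abs_of_nonpos (by linarith), abs_of_nonpos (by linarith)]
          linarith
        have h4 := hd h3
        rw [dist_coe] at h4
        linarith [(abs_lt.1 h4).2]
      · have hb : g^[n] x ≤ b := by
          change (g^[n] x : ℝ) ≤ b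
          linarith [min_le_right (η / 2) ((b : ℝ) - a)]
        rw [(hfix _).2 ⟨h, hb⟩]
        exact ⟨ih1, ih2⟩
  have h1 : (x : ℝ) ≤ g^[n] x := hinv.1
  have h2 := hx.trans_le (min_le_right _ _)
  rw [dist_coe] at h2 ⊢
  rw [abs_of_nonneg (by linarith)]
  linarith [(abs_lt.1 h2).1, hinv.2, min_le_left (η / 2) ((b : ℝ) - a)]

/-- The reflection `t ↦ 1 - t` turns this into the left-hand case. -/
theorem dist_iterate_le_of_near_right (hg : Continuous g) (hab : a < b)
    (hfix : ∀ x, g x = x ↔ x ∈ Set.Icc a b) {η : ℝ} (hη : 0 < η) :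
    ∃ δ > 0, ∀ x > b, dist x b < δ → ∀ n, dist (g^[n] x) x ≤ η := by
  have hconj : ∀ n x, (fun t => unitInterval.symm (g (unitInterval.symm t)))^[n] x =
      unitInterval.symm (g^[n] (unitInterval.symm x)) := by
    intro n
    induction n with
    | zero => intro x; simp
    | succ n ih => intro x; simp [iterate_succ_apply', ih]
  have hdist : ∀ x y, dist (unitInterval.symm x) (unitInterval.symm y) = dist x y := by
    intro x y
    rw [dist_coe, dist_coe, unitInterval.coe_symm_eq, unitInterval.coe_symm_eq, abs_sub_comm]
    congr 1
    ring
  obtain ⟨δ, hδ, hd⟩ := dist_iterate_le_of_near_left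
    (g := fun t => unitInterval.symm (g (unitInterval.symm t)))
    (a := unitInterval.symm b) (b := unitInterval.symm a) (by fun_prop)
    (unitInterval.symm_lt_symm.2 hab) (fun x => by
      rw [← unitInterval.symm_bijective.injective.eq_iff, unitInterval.symm_symm, hfix]
      rw [Set.mem_Icc, Set.mem_Icc, and_comm, unitInterval.le_symm_comm,
        unitInterval.symm_le_comm]) hη
  refine ⟨δ, hδ, fun x hx hxb n => ?_⟩
  have h := hd (unitInterval.symm x) (unitInterval.symm_lt_symm.2 hx) (by rwa [hdist]) n
  rwa [hconj, hdist, unitInterval.symm_symm] at h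

/-- When `a = b` no interval traps an overshooting orbit, so closeness is required along the whole
orbit. -/
theorem dist_iterate_le_of_near (hg : Continuous g) (hab : a ≤ b)
    (hfix : ∀ x, g x = x ↔ x ∈ Set.Icc a b) {η : ℝ} (hη : 0 < η) :
    ∃ δ > 0, ∀ x, (∀ n, ∃ p ∈ Set.Icc a b, dist (g^[n] x) p < δ) →
      ∀ n, dist (g^[n] x) x ≤ η := by
  rcases hab.eq_or_lt with rfl | hab
  · refine ⟨η / 2, by positivity, fun x hx n => ?_⟩
    have hxa : ∀ n, dist (g^[n] x) a < η / 2 := by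
      intro n
      obtain ⟨p, hp, h⟩ := hx n
      rwa [le_antisymm hp.2 hp.1] at h
    have h0 := hxa 0
    rw [iterate_zero_apply] at h0
    linarith [dist_triangle_right (g^[n] x) x a, hxa n]
  · obtain ⟨δ₁, hδ₁, h₁⟩ := dist_iterate_le_of_near_left hg hab hfix hη
    obtain ⟨δ₂, hδ₂, h₂⟩ := dist_iterate_le_of_near_right hg hab hfix hη
    refine ⟨min δ₁ δ₂, lt_min hδ₁ hδ₂, fun x hx n => ?_⟩
    obtain ⟨p, ⟨hap, hpb⟩, hp⟩ := hx 0
    rw [iterate_zero_apply] at hp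
    have hap' : (a : ℝ) ≤ p := hap
    have hpb' : (p : ℝ) ≤ b := hpb
    rcases lt_or_ge x a with hxa | hxa
    · refine h₁ x hxa (lt_of_le_of_lt ?_ (hp.trans_le (min_le_left _ _))) n
      have hxa' : (x : ℝ) < a := hxa
      rw [dist_coe, dist_coe, abs_of_nonpos (by linarith), abs_of_nonpos (by linarith)]
      linarith
    rcases lt_or_ge b x with hxb | hxb
    · refine h₂ x hxb (lt_of_le_of_lt ?_ (hp.trans_le (min_le_right _ _))) n
      have hxb' : (b : ℝ) < x := hxb
      rw [dist_coe, dist_coe, abs_of_nonneg (by linarith), abs_of_nonneg (by linarith)]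
      linarith
    · rw [iterate_fixed ((hfix x).2 ⟨hxa, hxb⟩), dist_self]
      exact hη.le

/-- By compactness some image `g^[N]` lies near `[a, b]`; orbits starting there remain near and
barely move. -/
theorem equicontinuous_iterate_of_fixedPts_eq_Icc (hg : Continuous g) (hab : a ≤ b)
    (hfix : ∀ x, g x = x ↔ x ∈ Set.Icc a b) (hfix₂ : ∀ x, g (g x) = x → x ∈ Set.Icc a b) :
    ∀ ε > 0, ∃ δ > 0, ∀ x y, dist x y < δ → ∀ n, dist (g^[n] x) (g^[n] y) ≤ ε := by
  refine equicontinuous_iterate_of_eventually_small hg fun ε hε => ?_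
  obtain ⟨δ, hδ, hd⟩ := dist_iterate_le_of_near hg hab hfix hε
  have hanti : Antitone fun n => Set.range g^[n] := by
    refine antitone_nat_of_succ_le fun n => ?_
    rintro _ ⟨u, rfl⟩
    exact ⟨g u, (iterate_succ_apply g n u).symm⟩
  obtain ⟨N, hN⟩ := exists_subset_nhds_of_isCompact (V := fun n => Set.range g^[n])
    (U := Metric.thickening δ (Set.Icc a b)) hanti.directed_ge
    (fun n => isCompact_range (hg.iterate n)) fun x hx =>
      Metric.isOpen_thickening.mem_nhds (Metric.self_subset_thickening hδ _
        (iInter_range_iterate_subset hg hab hfix hfix₂ hx))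
  refine ⟨N, fun x => hd _ fun n => ?_⟩
  rw [← Metric.mem_thickening_iff]
  refine hN ⟨g^[n] x, ?_⟩
  rw [← iterate_add_apply, ← iterate_add_apply, add_comm]

theorem polEntropy_eq_zero_of_isConnected {f : unitInterval → unitInterval} (hf : Continuous f)
    (h : IsConnected (periodicPts f)) : polEntropy f = 0 := by
  have htwo : ∀ x, f^[2] x = x ↔ x ∈ periodicPts f := fun x =>
    ⟨fun hx => ⟨2, two_pos, hx⟩, iterate_two_eq_of_mem_periodicPts hf h.isPreconnected.ordConnected⟩
  have hclosed : IsClosed (periodicPts f) := by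
    have : periodicPts f = {x | f^[2] x = x} := Set.ext fun x => (htwo x).symm
    rw [this]
    exact isClosed_eq (hf.iterate 2) continuous_id
  have hIcc := eq_Icc_of_connected_compact h hclosed.isCompact
  have hab : sInf (periodicPts f) ≤ sSup (periodicPts f) := by
    rw [← Set.nonempty_Icc, ← hIcc]
    exact h.nonempty
  refine polEntropy_eq_zero_of_equicontinuous f (equicontinuous_iterate_of_sq hf
    (equicontinuous_iterate_of_fixedPts_eq_Icc (hf.iterate 2) hab ?_ ?_))
  · intro x
    rw [← hIcc]
    exact htwo x
  · intro x hx
    rw [← hIcc]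
    exact ⟨4, by norm_num, hx⟩

theorem exists_isFixedPt {f : unitInterval → unitInterval} (hf : Continuous f) :
    ∃ x, f x = x := by
  obtain ⟨c, -, hc⟩ := exists_mem_Icc_isFixedPt hf.continuousOn bot_le bot_le le_top
  exact ⟨c, hc⟩

theorem isConnected_periodicPts_of_polEntropy_eq_zero {f : unitInterval → unitInterval}
    (hf : Continuous f) (h : polEntropy f = 0) : IsConnected (periodicPts f) := by
  obtain ⟨x, hx⟩ := exists_isFixedPt hf
  refine ⟨⟨x, 1, one_pos, hx⟩, Set.OrdConnected.isPreconnected ?_⟩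
  by_contra hne
  exact (polEntropy_pos_of_not_ordConnected hf hne).ne' h

theorem hasSharkovskiiType_one_or_two {f : unitInterval → unitInterval} (hf : Continuous f)
    (h : (periodicPts f).OrdConnected) :
    HasSharkovskiiType f (.num 1) ∨ HasSharkovskiiType f (.num 2) := by
  obtain ⟨x, hx⟩ := exists_isFixedPt hf
  have hone : 1 ∈ cyclePeriods f := ⟨one_pos, x, minimalPeriod_eq_one_iff_isFixedPt.2 hx⟩
  have hle : ∀ m ∈ cyclePeriods f, m = 1 ∨ m = 2 := by
    rintro m ⟨hm, y, rfl⟩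
    have hy := iterate_two_eq_of_mem_periodicPts hf h (minimalPeriod_pos_iff_mem_periodicPts.1 hm)
    exact (Nat.dvd_prime Nat.prime_two).1 (IsPeriodicPt.minimalPeriod_dvd hy)
  by_cases htwo : 2 ∈ cyclePeriods f
  · refine Or.inr ⟨htwo, fun m hm => ?_⟩
    rcases hle m hm with rfl | rfl
    · exact Or.inr (by simpa using SharkovskiiPrec.pow_pow 0 1 one_pos)
    · exact Or.inl rfl
  · refine Or.inl ⟨hone, fun m hm => ?_⟩
    rcases hle m hm with rfl | rfl
    · exact Or.inl rfl
    · exact absurd hm htwo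

end UnitInterval

end IntervalDynamics

theorem theorem4p16 (f : unitInterval → unitInterval) (hf : Continuous f) :
    (IntervalDynamics.polEntropy f = 0 ↔ IsConnected (Function.periodicPts f)) ∧
    (IntervalDynamics.polEntropy f = 0 →
      IntervalDynamics.HasSharkovskiiType f (.num 1) ∨
      IntervalDynamics.HasSharkovskiiType f (.num 2)) :=
  ⟨⟨IntervalDynamics.isConnected_periodicPts_of_polEntropy_eq_zero hf,
    IntervalDynamics.polEntropy_eq_zero_of_isConnected hf⟩,
    fun h => IntervalDynamics.hasSharkovskiiType_one_or_two hf
      (IntervalDynamics.isConnected_periodicPts_of_polEntropy_eq_zero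
        hf h).isPreconnected.ordConnected⟩
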